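/- Let $n\ge 1$ be an integer. For an integer $d$, let $\lambda(n,d)$ denote the smallest number of vertices of a (finite) triangulation $T$ of the $n$-sphere $S^n$ whose vertices can be labelled by $\{1,\dots,n+2\}$ in such a way that the simplicial map $T\to\partial\Delta^{n+1}$ induced by the labelling has degree $d$; here $\partial\Delta^{n+1}$ is the boundary of the $(n+1)$-simplex with vertices $1,\dots,n+2$, oriented as such, $T$ is oriented, and the degree of a simplicial map is the number of $n$-simplices of $T$ mapped onto a given $n$-simplex of $\partial\Delta^{n+1}$, counted with the sign $+1$ if the map preserves the orientation of the simplex and $-1$ if it reverses it (this number does not depend on the chosen $n$-simplex of $\partial\Delta^{n+1}$). Let $\alpha(n)=\limsup_{d\to\infty}\lambda(n,d)/d$. Then for every integer $d\ge 0$ such triangulations exist, and $$\lambda(n,d)\le \frac{n+2}{n}\,d+(2n+2).$$ In particular, $\alpha(n)\le \frac{n+2}{n}$. -/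

import Mathlib

open Geometry

/-- `K` is a (finite) triangulation of the `n`-sphere: a finite geometric simplicial complex
whose underlying space is homeomorphic to the unit sphere of `ℝ^(n+1)`. -/
def IsSphereTriangulation (n : ℕ) {m : ℕ}
    (K : SimplicialComplex ℝ (EuclideanSpace ℝ (Fin m))) : Prop :=
  K.faces.Finite ∧
    Nonempty (K.space ≃ₜ Metric.sphere (0 : EuclideanSpace ℝ (Fin (n + 1))) 1)

/-- `v` lists, without repetition, the vertices of an `n`-simplex of `K`. -/
def IsOrderedSimplex {m : ℕ} (K : SimplicialComplex ℝ (EuclideanSpace ℝ (Fin m))) {n : ℕ}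
    (v : Fin (n + 1) → EuclideanSpace ℝ (Fin m)) : Prop :=
  ∃ hv : Function.Injective v, Finset.univ.map ⟨v, hv⟩ ∈ K.faces

/-- `o` is an orientation of the `n`-dimensional complex `K`: each ordering of the vertices of an
`n`-simplex gets a sign, odd permutations of the vertices change the sign, and two different
`n`-simplices `x * w`, `y * w` with the common facet `w` are oriented coherently, that is, they
induce opposite orientations on `w`. -/
structure IsOrientation {m : ℕ} (K : SimplicialComplex ℝ (EuclideanSpace ℝ (Fin m))) (n : ℕ)
    (o : (Fin (n + 1) → EuclideanSpace ℝ (Fin m)) → ℤˣ) : Prop where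
  perm : ∀ (v : Fin (n + 1) → EuclideanSpace ℝ (Fin m)) (σ : Equiv.Perm (Fin (n + 1))),
    IsOrderedSimplex K v → o (v ∘ σ) = Equiv.Perm.sign σ * o v
  coherent : ∀ (x y : EuclideanSpace ℝ (Fin m)) (w : Fin n → EuclideanSpace ℝ (Fin m)),
    IsOrderedSimplex K (Fin.cons x w : Fin (n + 1) → EuclideanSpace ℝ (Fin m)) →
    IsOrderedSimplex K (Fin.cons y w : Fin (n + 1) → EuclideanSpace ℝ (Fin m)) →
    x ≠ y →
    o (Fin.cons x w : Fin (n + 1) → EuclideanSpace ℝ (Fin m)) =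
      -o (Fin.cons y w : Fin (n + 1) → EuclideanSpace ℝ (Fin m))

/-- The signed number of `n`-simplices of `K` that the simplicial map given by the labelling `L`
maps onto the `n`-simplex of `∂Δ^(n+1)` opposite to the vertex `i`. The vertices of `∂Δ^(n+1)` are
the elements of `Fin (n + 2)`. In the orientation of `∂Δ^(n+1)` as the boundary of `Δ^(n+1)` the
simplex opposite to `i`, with its vertices in increasing order (which is `i.succAbove`), has the
sign `(-1)^i`. Every `n`-simplex of `K` mapped onto it has exactly one ordering `v` of its vertices
with `L ∘ v = i.succAbove`, and the map preserves the orientation on it iff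
`o v = (-1)^i`. -/
noncomputable def signedCount {m : ℕ} (K : SimplicialComplex ℝ (EuclideanSpace ℝ (Fin m)))
    {n : ℕ} (o : (Fin (n + 1) → EuclideanSpace ℝ (Fin m)) → ℤˣ)
    (L : EuclideanSpace ℝ (Fin m) → Fin (n + 2)) (i : Fin (n + 2)) : ℤ :=
  ∑ᶠ v ∈ {v : Fin (n + 1) → EuclideanSpace ℝ (Fin m) |
      IsOrderedSimplex K v ∧ L ∘ v = i.succAbove},
    (-1) ^ (i : ℕ) * (o v : ℤ)

/-- The simplicial map to `∂Δ^(n+1)` given by the labelling `L` of the vertices of the complex `K`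
with orientation `o` has degree `d`. Only the values of `L` at vertices of `K` matter. -/
def HasDegree {m : ℕ} (K : SimplicialComplex ℝ (EuclideanSpace ℝ (Fin m)))
    {n : ℕ} (o : (Fin (n + 1) → EuclideanSpace ℝ (Fin m)) → ℤˣ)
    (L : EuclideanSpace ℝ (Fin m) → Fin (n + 2)) (d : ℤ) : Prop :=
  ∀ i : Fin (n + 2), signedCount K o L i = d

/-- Some oriented triangulation of the `n`-sphere with exactly `N` vertices has a labelling of its
vertices by `n + 2` labels for which the simplicial map to `∂Δ^(n+1)` has degree `d`. -/
def AdmitsDegree (n : ℕ) (d : ℤ) (N : ℕ) : Prop :=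
  ∃ (m : ℕ) (K : SimplicialComplex ℝ (EuclideanSpace ℝ (Fin m)))
    (o : (Fin (n + 1) → EuclideanSpace ℝ (Fin m)) → ℤˣ)
    (L : EuclideanSpace ℝ (Fin m) → Fin (n + 2)),
    IsSphereTriangulation n K ∧ IsOrientation K n o ∧ HasDegree K o L d ∧
      K.vertices.ncard = N

/-- `λ(n,d)`, the smallest number of vertices of a triangulation of the `n`-sphere that has a
labelling of degree `d`. -/
noncomputable def lam (n : ℕ) (d : ℤ) : ℕ :=
  sInf {N : ℕ | AdmitsDegree n d N}

/-- `α(n) = limsup_{d → ∞} λ(n,d) / d`. -/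
noncomputable def alpha (n : ℕ) : EReal :=
  Filter.limsup (fun d : ℕ => (((lam n (d : ℤ) : ℝ) / (d : ℝ) : ℝ) : EReal)) Filter.atTop

/-! Let σ be an n-simplex of a labelled, oriented triangulated sphere that carries every label
except c, and insert its barycenter as a new vertex with label c. Over the simplex of `∂Δ^(n+1)`
opposite to c, σ is lost. Over each of the n+1 other simplices exactly one new simplex is gained. It
is oriented as σ with one vertex replaced by the barycenter, while its image crosses a facet of
`∂Δ^(n+1)`, so its sign is opposite to that of σ. Hence every signed count, and so the degree, drops
by the sign of σ (`signedCount_stellarSubdivision`).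

One new vertex therefore raises the degree by one if σ is reversed and lowers it by one otherwise. A
lowering creates n+1 reversed simplices (`le_ncard_reversedSimplices`), each of which can then be
used for a raising. One lowering followed by n+1 raisings costs n+2 vertices and gains degree n,
which is the ratio (n+2)/n. The start is `∂Δ^(n+1)` itself, with degree 1 and n+2 vertices. Stopping
inside a round reaches the intermediate degrees, and the invariant of `exists_admitsReversed` bounds
the resulting error. Degree 0 needs a single lowering.

What remains is that subdividing gives a complex with the same underlying space (a computation in
barycentric coordinates) and that the orientation carries over (`IsOrientation.subdivide`). -/

/-! ### Barycentric coordinates and cones from the barycenter -/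

section Hull

variable {E : Type*} [AddCommGroup E] [Module ℝ E]

/-- The centroid of a finite set of points, as a linear combination. -/
noncomputable def barycenter (σ : Finset E) : E := ∑ y ∈ σ, (σ.card : ℝ)⁻¹ • y

theorem AffineIndependent.weights_eq {σ : Finset E}
    (h : AffineIndependent ℝ ((↑) : σ → E)) {w w' : E → ℝ}
    (hs : ∑ y ∈ σ, w y = ∑ y ∈ σ, w' y) (hv : ∑ y ∈ σ, w y • y = ∑ y ∈ σ, w' y • y) :
    ∀ y ∈ σ, w y = w' y := by
  rw [affineIndependent_iff] at h
  intro y hy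
  have := h Finset.univ (fun z : σ => w z - w' z) ?_ ?_ ⟨y, hy⟩ (Finset.mem_univ _)
  · exact sub_eq_zero.1 this
  · rw [Finset.sum_coe_sort σ (fun z => w z - w' z), Finset.sum_sub_distrib, hs, sub_self]
  · simp only [sub_smul]
    rw [Finset.sum_coe_sort σ (fun z => w z • z - w' z • z), Finset.sum_sub_distrib, hv, sub_self]

theorem barycenter_mem_convexHull {σ : Finset E} (hσ : σ.Nonempty) :
    barycenter σ ∈ convexHull ℝ (σ : Set E) := by
  have hpos : (σ.card : ℝ) ≠ 0 := by simpa using hσ.ne_empty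
  rw [Finset.mem_convexHull']
  exact ⟨fun _ => (σ.card : ℝ)⁻¹, fun _ _ => by positivity, by simp [hpos], rfl⟩

theorem affineIndependent_of_weights {σ : Finset E}
    (h : ∀ w : E → ℝ, ∑ y ∈ σ, w y = 0 → ∑ y ∈ σ, w y • y = 0 → ∀ y ∈ σ, w y = 0) :
    AffineIndependent ℝ ((↑) : σ → E) := by
  classical
  rw [affineIndependent_iff_of_fintype]
  intro w hw hv i
  rw [Finset.weightedVSub_eq_linear_combination _ hw] at hv
  let W : E → ℝ := fun y => if hy : y ∈ σ then w ⟨y, hy⟩ else 0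
  have hW : ∀ y : σ, W y = w y := fun y => by simp [W]
  rw [← hW]
  refine h W ?_ ?_ i i.2
  · rw [← Finset.sum_coe_sort σ, ← hw]
    exact Finset.sum_congr rfl fun y _ => hW y
  · rw [← Finset.sum_coe_sort σ, ← hv]
    exact Finset.sum_congr rfl fun y _ => by rw [hW]

theorem mem_convexHull_of_weights {σ τ : Finset E} (hτ : τ ⊆ σ) {x : E} (a : E → ℝ)
    (h0 : ∀ y ∈ σ, 0 ≤ a y) (hs : ∀ y ∈ σ, y ∉ τ → a y = 0) (h1 : ∑ y ∈ σ, a y = 1)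
    (h2 : ∑ y ∈ σ, a y • y = x) : x ∈ convexHull ℝ (τ : Set E) := by
  rw [Finset.mem_convexHull']
  refine ⟨a, fun y hy => h0 y (hτ hy), ?_, ?_⟩
  · rw [← h1]
    exact Finset.sum_subset hτ hs
  · rw [← h2]
    exact Finset.sum_subset hτ fun y hy hy' => by rw [hs y hy hy', zero_smul]

variable [DecidableEq E]

theorem barycenter_notMem {σ : Finset E} (h : AffineIndependent ℝ ((↑) : σ → E))
    (hc : 2 ≤ σ.card) : barycenter σ ∉ σ := by
  intro hb
  obtain ⟨z, hz, hzb⟩ := Finset.exists_mem_ne hc (barycenter σ)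
  have hpos : (σ.card : ℝ) ≠ 0 := by positivity
  -- If the barycenter were a vertex, the point mass there and the uniform weights would represent
  -- the same point; they differ at `z`.
  have := h.weights_eq (w := fun y => if y = barycenter σ then 1 else 0)
    (w' := fun _ => (σ.card : ℝ)⁻¹) (by simp [hb, hpos]) (by simp [hb, ite_smul]; rfl) z hz
  simp [hzb] at this
  simp [← this] at hpos

/-- Rewriting a combination of `insert (barycenter σ) τ` as a combination of `σ`. -/
theorem sum_insert_barycenter {M : Type*} [AddCommGroup M] [Module ℝ M] {σ τ : Finset E}
    (hτ : τ ⊆ σ) (hb : barycenter σ ∉ τ) (w : E → ℝ) (f : E → M)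
    (hf : f (barycenter σ) = ∑ y ∈ σ, (σ.card : ℝ)⁻¹ • f y) :
    ∑ y ∈ insert (barycenter σ) τ, w y • f y =
      ∑ y ∈ σ, ((if y ∈ τ then w y else 0) + w (barycenter σ) * (σ.card : ℝ)⁻¹) • f y := by
  rw [Finset.sum_insert hb, hf, Finset.smul_sum, add_comm]
  simp only [add_smul, Finset.sum_add_distrib, ite_smul, zero_smul, mul_smul]
  rw [Finset.sum_ite_mem, Finset.inter_eq_right.2 hτ]

theorem sum_insert_barycenter_one {σ τ : Finset E} (hne : σ.Nonempty)
    (hτ : τ ⊆ σ) (hb : barycenter σ ∉ τ) (w : E → ℝ) :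
    ∑ y ∈ insert (barycenter σ) τ, w y =
      ∑ y ∈ σ, ((if y ∈ τ then w y else 0) + w (barycenter σ) * (σ.card : ℝ)⁻¹) := by
  have hpos : (σ.card : ℝ) ≠ 0 := by simpa using hne.ne_empty
  simpa using sum_insert_barycenter hτ hb w (fun _ => (1 : ℝ)) (by simp [hpos])

/-- The weight of the barycenter spreads evenly over σ and adds the same share `t` to every
coordinate. When τ is proper, `t` is the least coordinate of the point, so affine independence
determines it; the intersection lemmas below rest on this. -/
theorem mem_convexHull_insert_barycenter {σ τ : Finset E} (hne : σ.Nonempty)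
    (hτ : τ ⊆ σ) (hb : barycenter σ ∉ σ) {x : E} :
    x ∈ convexHull ℝ ((insert (barycenter σ) τ : Finset E) : Set E) ↔
      ∃ (a : E → ℝ) (t : ℝ), 0 ≤ t ∧ (∀ y, 0 ≤ a y) ∧ (∀ y, y ∉ τ → a y = 0) ∧
        ∑ y ∈ σ, (a y + t) = 1 ∧ ∑ y ∈ σ, (a y + t) • y = x := by
  have hbτ : barycenter σ ∉ τ := fun h => hb (hτ h)
  have hpos : (σ.card : ℝ) ≠ 0 := by simpa using hne.ne_empty
  rw [Finset.mem_convexHull']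
  constructor
  · rintro ⟨w, h0, h1, h2⟩
    rw [sum_insert_barycenter_one hne hτ hbτ] at h1
    rw [sum_insert_barycenter hτ hbτ w (fun y => y) rfl] at h2
    refine ⟨fun y => if y ∈ τ then w y else 0, w (barycenter σ) * (σ.card : ℝ)⁻¹,
      mul_nonneg (h0 _ (by simp)) (by positivity), fun y => ?_, fun y hy => by simp [hy], h1, h2⟩
    dsimp only
    split_ifs with hy
    · exact h0 _ (by simp [hy])
    · rfl
  · rintro ⟨a, t, ht, ha, ha', h1, h2⟩
    let w : E → ℝ := fun y => if y = barycenter σ then t * σ.card else a y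
    have key : ∀ y ∈ σ, (if y ∈ τ then w y else 0) + w (barycenter σ) * (σ.card : ℝ)⁻¹ =
        a y + t := by
      intro y hy
      have hyb : y ≠ barycenter σ := fun h => hb (h ▸ hy)
      by_cases hyτ : y ∈ τ
      · simp [w, hyτ, hyb, hpos]
      · simp [w, hyτ, hpos, ha' y hyτ]
    refine ⟨w, fun y _ => ?_, ?_, ?_⟩
    · by_cases hyb : y = barycenter σ
      · simp only [w, hyb, if_true]; positivity
      · simpa [w, hyb] using ha y
    · rw [sum_insert_barycenter_one hne hτ hbτ, Finset.sum_congr rfl key, h1]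
    · rw [sum_insert_barycenter hτ hbτ w (fun y => y) rfl, ← h2]
      exact Finset.sum_congr rfl fun y hy => by rw [key y hy]

theorem exists_weights_of_mem_convexHull {σ τ : Finset E} (hτ : τ ⊆ σ) {x : E}
    (hx : x ∈ convexHull ℝ (τ : Set E)) :
    ∃ a : E → ℝ, (∀ y, 0 ≤ a y) ∧ (∀ y, y ∉ τ → a y = 0) ∧ ∑ y ∈ σ, a y = 1 ∧
      ∑ y ∈ σ, a y • y = x := by
  rw [Finset.mem_convexHull'] at hx
  obtain ⟨w, h0, h1, h2⟩ := hx
  refine ⟨fun y => if y ∈ τ then w y else 0, fun y => ?_, fun y hy => by simp [hy], ?_, ?_⟩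
  · dsimp only
    split_ifs with hy
    exacts [h0 y hy, le_rfl]
  · rw [Finset.sum_ite_mem, Finset.inter_eq_right.2 hτ, h1]
  · simp only [ite_smul, zero_smul]
    rw [Finset.sum_ite_mem, Finset.inter_eq_right.2 hτ, h2]

theorem affineIndependent_insert_barycenter {σ τ : Finset E}
    (h : AffineIndependent ℝ ((↑) : σ → E)) (hτ : τ ⊂ σ) (hb : barycenter σ ∉ σ) :
    AffineIndependent ℝ ((↑) : (insert (barycenter σ) τ : Finset E) → E) := by
  have hne : σ.Nonempty := ⟨_, (Finset.exists_of_ssubset hτ).choose_spec.1⟩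
  have hbτ : barycenter σ ∉ τ := fun h => hb (hτ.1 h)
  have hpos : (σ.card : ℝ) ≠ 0 := by simpa using hne.ne_empty
  refine affineIndependent_of_weights fun w hw hv => ?_
  rw [sum_insert_barycenter_one hne hτ.1 hbτ] at hw
  rw [sum_insert_barycenter hτ.1 hbτ w (fun y => y) rfl] at hv
  have heq := h.weights_eq (w' := fun _ => 0) (hw.trans (by simp)) (hv.trans (by simp))
  obtain ⟨p, hp, hpτ⟩ := Finset.exists_of_ssubset hτ
  -- A vertex `p` outside τ receives weight from the barycenter only.
  have hwb : w (barycenter σ) = 0 := by simpa [hpτ, hpos] using heq p hp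
  intro y hy
  rcases Finset.mem_insert.1 hy with rfl | hy
  · exact hwb
  · simpa [hwb, hy] using heq y (hτ.1 hy)

theorem convexHull_insert_barycenter_subset {σ τ : Finset E} (hne : σ.Nonempty) (hτ : τ ⊆ σ) :
    convexHull ℝ ((insert (barycenter σ) τ : Finset E) : Set E) ⊆ convexHull ℝ (σ : Set E) := by
  refine convexHull_min ?_ (convex_convexHull ℝ _)
  intro y hy
  rcases Finset.mem_insert.1 (Finset.mem_coe.1 hy) with rfl | hy
  · exact barycenter_mem_convexHull hne
  · exact subset_convexHull ℝ _ (hτ hy)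

theorem exists_mem_convexHull_insert_barycenter {σ : Finset E} (hne : σ.Nonempty)
    (hb : barycenter σ ∉ σ) {x : E} (hx : x ∈ convexHull ℝ (σ : Set E)) :
    ∃ τ ⊂ σ, x ∈ convexHull ℝ ((insert (barycenter σ) τ : Finset E) : Set E) := by
  obtain ⟨a, h0, -, h1, h2⟩ := exists_weights_of_mem_convexHull (Finset.Subset.refl σ) hx
  obtain ⟨z, hz, hmin⟩ := σ.exists_min_image a hne
  refine ⟨σ.erase z, Finset.erase_ssubset hz, ?_⟩
  rw [mem_convexHull_insert_barycenter hne (Finset.erase_subset _ _) hb]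
  -- The least coordinate becomes the common share, so its vertex `z` is no longer needed.
  refine ⟨fun y => if y ∈ σ.erase z then a y - a z else 0, a z, h0 z, fun y => ?_,
    fun y hy => by simp only [hy, if_false], ?_, ?_⟩
  · dsimp only
    split_ifs with hy
    · exact sub_nonneg.2 (hmin y (Finset.mem_of_mem_erase hy))
    · rfl
  all_goals
    first
    | rw [← h1]
    | rw [← h2]
    refine Finset.sum_congr rfl fun y hy => ?_
    by_cases hyz : y = z
    · simp [hyz]
    · simp [hyz, hy]

theorem convexHull_insert_barycenter_inter_face {σ τ ρ : Finset E}
    (h : AffineIndependent ℝ ((↑) : σ → E)) (hτ : τ ⊂ σ) (hb : barycenter σ ∉ σ)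
    (hρ : ρ ⊂ σ) :
    convexHull ℝ ((insert (barycenter σ) τ : Finset E) : Set E) ∩ convexHull ℝ (ρ : Set E) ⊆
      convexHull ℝ ((τ ∩ ρ : Finset E) : Set E) := by
  have hne : σ.Nonempty := ⟨_, (Finset.exists_of_ssubset hτ).choose_spec.1⟩
  rintro x ⟨hx1, hx2⟩
  rw [mem_convexHull_insert_barycenter hne hτ.1 hb] at hx1
  obtain ⟨a, t, ht, ha, ha', h1, h2⟩ := hx1
  obtain ⟨c, -, hc', h3, h4⟩ := exists_weights_of_mem_convexHull hρ.1 hx2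
  have heq := h.weights_eq (h1.trans h3.symm) (h2.trans h4.symm)
  obtain ⟨p, hp, hpρ⟩ := Finset.exists_of_ssubset hρ
  -- A point of the face ρ has coordinate 0 at `p`, so the common share vanishes.
  have ht0 : t = 0 := by linarith [heq p hp, hc' p hpρ, ha p]
  subst ht0
  simp only [add_zero] at *
  refine mem_convexHull_of_weights (Finset.inter_subset_left.trans hτ.1) a (fun y _ => ha y)
    (fun y hy hy' => ?_) h1 h2
  by_cases hyτ : y ∈ τ
  · rw [heq y hy]
    exact hc' y fun h => hy' (Finset.mem_inter.2 ⟨hyτ, h⟩)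
  · exact ha' y hyτ

theorem convexHull_insert_barycenter_inter_insert {σ τ ρ : Finset E}
    (h : AffineIndependent ℝ ((↑) : σ → E)) (hτ : τ ⊂ σ) (hb : barycenter σ ∉ σ)
    (hρ : ρ ⊂ σ) :
    convexHull ℝ ((insert (barycenter σ) τ : Finset E) : Set E) ∩
        convexHull ℝ ((insert (barycenter σ) ρ : Finset E) : Set E) ⊆
      convexHull ℝ ((insert (barycenter σ) (τ ∩ ρ) : Finset E) : Set E) := by
  have hne : σ.Nonempty := ⟨_, (Finset.exists_of_ssubset hτ).choose_spec.1⟩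
  rintro x ⟨hx1, hx2⟩
  rw [mem_convexHull_insert_barycenter hne hτ.1 hb] at hx1
  rw [mem_convexHull_insert_barycenter hne hρ.1 hb] at hx2
  rw [mem_convexHull_insert_barycenter hne (Finset.inter_subset_left.trans hτ.1) hb]
  obtain ⟨a, t, ht, ha, ha', h1, h2⟩ := hx1
  obtain ⟨c, s, hs, hc, hc', h3, h4⟩ := hx2
  have heq := h.weights_eq (h1.trans h3.symm) (h2.trans h4.symm)
  obtain ⟨p, hp, hpρ⟩ := Finset.exists_of_ssubset hρ
  obtain ⟨q, hq, hqτ⟩ := Finset.exists_of_ssubset hτ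
  -- Comparing coordinates at `p` gives `t ≤ s`, and at `q` gives `s ≤ t`.
  have hts : t = s := by linarith [heq p hp, heq q hq, hc' p hpρ, ha' q hqτ, ha p, hc q]
  subst hts
  refine ⟨a, t, ht, ha, fun y hy => ?_, h1, h2⟩
  by_cases hyτ : y ∈ τ
  · have hyρ : y ∉ ρ := fun h => hy (Finset.mem_inter.2 ⟨hyτ, h⟩)
    linarith [heq y (hτ.1 hyτ), hc' y hyρ]
  · exact ha' y hyτ

end Hull

/-! ### Stellar subdivision of a facet -/

section Subdivision

theorem finite_vertices_of_finite_faces {E : Type*} [AddCommGroup E] [Module ℝ E]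
    {K : SimplicialComplex ℝ E} (hK : K.faces.Finite) : K.vertices.Finite :=
  (hK.preimage (Finset.singleton_injective.injOn)).subset fun _ hx => hx

variable {E : Type*} [AddCommGroup E] [Module ℝ E] [DecidableEq E]

/-- A vertex of `K` lying in the hull of σ must belong to σ, and the barycenter of at least two
affinely independent points is none of them. -/
theorem Geometry.SimplicialComplex.barycenter_notMem_of_mem_faces {K : SimplicialComplex ℝ E}
    {σ s : Finset E} (hσ : σ ∈ K.faces) (hc : 2 ≤ σ.card) (hs : s ∈ K.faces) :
    barycenter σ ∉ s := by
  intro hb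
  have hv : barycenter σ ∈ K.vertices :=
    K.down_closed hs (Finset.singleton_subset_iff.2 hb) (Finset.singleton_nonempty _)
  exact barycenter_notMem (K.indep hσ) hc
    ((SimplicialComplex.vertex_mem_convexHull_iff hv hσ).1
      (barycenter_mem_convexHull (K.nonempty_of_mem_faces hσ)))

/-- The stellar subdivision of a complex at the barycenter of a facet `σ`. -/
noncomputable def stellarSubdivision (K : SimplicialComplex ℝ E) (σ : Finset E)
    (hσ : σ ∈ K.facets) (hc : 2 ≤ σ.card) : SimplicialComplex ℝ E where
  -- Since σ is maximal, it is the only face to remove. The choice `τ = ∅` gives the new vertex.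
  faces := {s | (s ∈ K.faces ∧ s ≠ σ) ∨ ∃ τ ⊂ σ, s = insert (barycenter σ) τ}
  isRelLowerSet_faces := by
    have hnot := fun {s} => K.barycenter_notMem_of_mem_faces (s := s) hσ.1 hc
    rintro s (⟨hs, hsσ⟩ | ⟨τ, hτ, rfl⟩)
    · refine ⟨K.nonempty_of_mem_faces hs, fun t hts ht => Or.inl ⟨K.down_closed hs hts ht, ?_⟩⟩
      rintro rfl
      exact hsσ (hσ.2 hs hts).symm
    · refine ⟨Finset.insert_nonempty _ _, fun t hts ht => ?_⟩
      by_cases hbt : barycenter σ ∈ t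
      · exact Or.inr ⟨t.erase (barycenter σ),
          (Finset.subset_insert_iff.1 hts).trans_ssubset hτ,
          (Finset.insert_erase hbt).symm⟩
      · have htτ : t ⊆ τ := (Finset.subset_insert_iff_of_notMem hbt).1 hts
        have := htτ.trans_ssubset hτ
        exact Or.inl ⟨K.down_closed hσ.1 this.1 ht, this.ne⟩
  indep := by
    rintro s (⟨hs, -⟩ | ⟨τ, hτ, rfl⟩)
    · exact K.indep hs
    · exact affineIndependent_insert_barycenter (K.indep hσ.1) hτ
        (K.barycenter_notMem_of_mem_faces hσ.1 hc hσ.1)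
  inter_subset_convexHull := by
    have hb := K.barycenter_notMem_of_mem_faces hσ.1 hc hσ.1
    have hmix : ∀ s τ : Finset E, s ∈ K.faces → s ≠ σ → τ ⊂ σ →
        convexHull ℝ ((insert (barycenter σ) τ : Finset E) : Set E) ∩ convexHull ℝ (s : Set E) ⊆
          convexHull ℝ (((insert (barycenter σ) τ : Finset E) : Set E) ∩ s) := by
      intro s τ hs hsσ hτ x hx
      have hx' := K.inter_subset_convexHull hσ.1 hs
        ⟨convexHull_insert_barycenter_subset (K.nonempty_of_mem_faces hσ.1) hτ.1 hx.1, hx.2⟩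
      rw [← Finset.coe_inter] at hx'
      -- Maximality of σ: a face other than σ meets it in a proper face.
      have hss : σ ∩ s ⊂ σ := by
        refine Finset.inter_subset_left.ssubset_of_ne fun h => hsσ ?_
        exact (hσ.2 hs (Finset.inter_eq_left.1 h)).symm
      refine convexHull_mono ?_
        (convexHull_insert_barycenter_inter_face (K.indep hσ.1) hτ hb hss ⟨hx.1, hx'⟩)
      intro y hy
      simp only [Finset.coe_inter, Set.mem_inter_iff, Finset.mem_coe] at hy
      simp [hy.1, hy.2.2]
    rintro s t (⟨hs, hsσ⟩ | ⟨τ, hτ, rfl⟩) (⟨ht, htσ⟩ | ⟨ρ, hρ, rfl⟩)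
    · exact K.inter_subset_convexHull hs ht
    · rw [Set.inter_comm, Set.inter_comm (s : Set E)]
      exact hmix s ρ hs hsσ hρ
    · exact hmix t τ ht htσ hτ
    · refine (convexHull_insert_barycenter_inter_insert (K.indep hσ.1) hτ hb hρ).trans
        (convexHull_mono ?_)
      rw [← Finset.coe_inter, Finset.insert_inter_distrib]

variable {K : SimplicialComplex ℝ E} {σ : Finset E} (hσ : σ ∈ K.facets) (hc : 2 ≤ σ.card)

theorem mem_faces_stellarSubdivision {s : Finset E} :
    s ∈ (stellarSubdivision K σ hσ hc).faces ↔
      (s ∈ K.faces ∧ s ≠ σ) ∨ ∃ τ ⊂ σ, s = insert (barycenter σ) τ := Iff.rfl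

theorem space_stellarSubdivision : (stellarSubdivision K σ hσ hc).space = K.space := by
  have hb := K.barycenter_notMem_of_mem_faces hσ.1 hc hσ.1
  have hne := K.nonempty_of_mem_faces hσ.1
  ext x
  simp only [SimplicialComplex.mem_space_iff, mem_faces_stellarSubdivision]
  constructor
  · rintro ⟨s, ⟨hs, -⟩ | ⟨τ, hτ, rfl⟩, hx⟩
    · exact ⟨s, hs, hx⟩
    · exact ⟨σ, hσ.1, convexHull_insert_barycenter_subset hne hτ.1 hx⟩
  · rintro ⟨s, hs, hx⟩
    by_cases hsσ : s = σ
    · subst hsσ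
      obtain ⟨τ, hτ, hx'⟩ := exists_mem_convexHull_insert_barycenter hne hb hx
      exact ⟨_, Or.inr ⟨τ, hτ, rfl⟩, hx'⟩
    · exact ⟨s, Or.inl ⟨hs, hsσ⟩, hx⟩

theorem finite_faces_stellarSubdivision (hK : K.faces.Finite) :
    (stellarSubdivision K σ hσ hc).faces.Finite := by
  refine (hK.union ((σ.powerset.finite_toSet).image (insert (barycenter σ)))).subset ?_
  rintro s (⟨hs, -⟩ | ⟨τ, hτ, rfl⟩)
  · exact Or.inl hs
  · exact Or.inr ⟨τ, by simpa using hτ.1, rfl⟩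

theorem card_le_of_mem_faces_stellarSubdivision {n : ℕ} (hK : ∀ s ∈ K.faces, s.card ≤ n) :
    ∀ s ∈ (stellarSubdivision K σ hσ hc).faces, s.card ≤ n := by
  rintro s (⟨hs, -⟩ | ⟨τ, hτ, rfl⟩)
  · exact hK s hs
  · exact (Finset.card_insert_le _ _).trans ((Finset.card_lt_card hτ).trans_le (hK σ hσ.1))

theorem vertices_stellarSubdivision :
    (stellarSubdivision K σ hσ hc).vertices = insert (barycenter σ) K.vertices := by
  ext x
  simp only [SimplicialComplex.mem_vertices, mem_faces_stellarSubdivision, Set.mem_insert_iff]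
  constructor
  · rintro (⟨hs, -⟩ | ⟨τ, hτ, hx⟩)
    · exact Or.inr hs
    · have : barycenter σ ∈ ({x} : Finset E) := hx ▸ Finset.mem_insert_self _ _
      exact Or.inl (Finset.mem_singleton.1 this).symm
  · rintro (rfl | hx)
    · refine Or.inr ⟨∅, Finset.empty_ssubset.2 (K.nonempty_of_mem_faces hσ.1), by simp⟩
    · refine Or.inl ⟨hx, ?_⟩
      rintro rfl
      simp at hc

theorem ncard_vertices_stellarSubdivision (hK : K.faces.Finite) :
    (stellarSubdivision K σ hσ hc).vertices.ncard = K.vertices.ncard + 1 := by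
  rw [vertices_stellarSubdivision]
  refine Set.ncard_insert_of_notMem (fun h => ?_) (finite_vertices_of_finite_faces hK)
  exact K.barycenter_notMem_of_mem_faces hσ.1 hc h (Finset.mem_singleton_self _)

end Subdivision

/-! ### Finiteness of the set of ordered simplices -/

section Ordered

variable {m n : ℕ} {K : SimplicialComplex ℝ (EuclideanSpace ℝ (Fin m))}

theorem isOrderedSimplex_iff [DecidableEq (EuclideanSpace ℝ (Fin m))]
    {v : Fin (n + 1) → EuclideanSpace ℝ (Fin m)} :
    IsOrderedSimplex K v ↔ Function.Injective v ∧ Finset.univ.image v ∈ K.faces := by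
  simp only [IsOrderedSimplex, Finset.map_eq_image, Function.Embedding.coeFn_mk, exists_prop]

theorem finite_setOf_isOrderedSimplex (hK : K.faces.Finite) :
    {v : Fin (n + 1) → EuclideanSpace ℝ (Fin m) | IsOrderedSimplex K v}.Finite := by
  classical
  refine (Set.Finite.pi' fun _ : Fin (n + 1) => finite_vertices_of_finite_faces hK).subset ?_
  intro v hv j
  rw [Set.mem_ofPred_eq, isOrderedSimplex_iff] at hv
  exact K.down_closed hv.2 (by simp) (Finset.singleton_nonempty _)

end Ordered

/-! ### Replacing the barycenter by the missing vertex -/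

section Fill

variable {E : Type*} [AddCommGroup E] [Module ℝ E] {n : ℕ}

open Classical in
/-- A vertex of `σ` outside of `S`, if there is one. -/
noncomputable def missingVertex (σ : Finset E) (S : Set E) : E :=
  if h : ∃ p ∈ σ, p ∉ S then h.choose else barycenter σ

open Classical in
/-- Replace the barycenter of `σ` in the list `v` by a vertex of `σ` missing in `v`. -/
noncomputable def fillVertex (σ : Finset E) (v : Fin (n + 1) → E) : Fin (n + 1) → E :=
  fun k => if v k = barycenter σ then missingVertex σ (Set.range v) else v k

theorem missingVertex_eq {σ : Finset E} {S : Set E} {p : E} (hp : p ∈ σ) (hpS : p ∉ S)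
    (h : ∀ q ∈ σ, q ∉ S → q = p) : missingVertex σ S = p := by
  have hex : ∃ p ∈ σ, p ∉ S := ⟨p, hp, hpS⟩
  rw [missingVertex, dif_pos hex]
  exact h _ hex.choose_spec.1 hex.choose_spec.2

theorem fillVertex_of_notMem {σ : Finset E} {v : Fin (n + 1) → E}
    (h : ∀ k, v k ≠ barycenter σ) : fillVertex σ v = v := by
  ext k
  simp [fillVertex, h k]

theorem fillVertex_comp_perm (σ : Finset E) (v : Fin (n + 1) → E)
    (π : Equiv.Perm (Fin (n + 1))) : fillVertex σ (v ∘ π) = fillVertex σ v ∘ π := by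
  ext k
  simp [fillVertex, π.surjective.range_comp]

theorem fillVertex_eq_update {σ : Finset E} {v : Fin (n + 1) → E} (hv : Function.Injective v)
    {j : Fin (n + 1)} (hj : v j = barycenter σ) {p : E} (hp : p ∈ σ) (hpv : p ∉ Set.range v)
    (h : ∀ q ∈ σ, q ∉ Set.range v → q = p) : fillVertex σ v = Function.update v j p := by
  ext k
  by_cases hk : k = j
  · subst hk
    simp [fillVertex, hj, missingVertex_eq hp hpv h]
  · have : v k ≠ barycenter σ := fun h => hk (hv (h.trans hj.symm))
    simp [fillVertex, this, hk]

end Fill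

/-! ### Orientation of the subdivision -/

section Orientation

variable {m n : ℕ} [DecidableEq (EuclideanSpace ℝ (Fin m))]
  {K : SimplicialComplex ℝ (EuclideanSpace ℝ (Fin m))}
  {σ : Finset (EuclideanSpace ℝ (Fin m))} (hσ : σ ∈ K.facets) (hc : 2 ≤ σ.card)
  {v : Fin (n + 1) → EuclideanSpace ℝ (Fin m)}

theorem isOrderedSimplex_stellarSubdivision_iff :
    IsOrderedSimplex (stellarSubdivision K σ hσ hc) v ↔
      (IsOrderedSimplex K v ∧ Finset.univ.image v ≠ σ) ∨
        (Function.Injective v ∧ ∃ τ ⊂ σ, Finset.univ.image v = insert (barycenter σ) τ) := by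
  simp only [isOrderedSimplex_iff, mem_faces_stellarSubdivision]
  tauto

include hσ hc in
theorem IsOrderedSimplex.ne_barycenter (hv : IsOrderedSimplex K v) (k : Fin (n + 1)) :
    v k ≠ barycenter σ := by
  rw [isOrderedSimplex_iff] at hv
  intro h
  exact K.barycenter_notMem_of_mem_faces hσ.1 hc hv.2 (h ▸ Finset.mem_image_of_mem v (by simp))

theorem IsOrderedSimplex.of_stellarSubdivision
    (hv : IsOrderedSimplex (stellarSubdivision K σ hσ hc) v) (hb : ∀ k, v k ≠ barycenter σ) :
    IsOrderedSimplex K v ∧ Finset.univ.image v ≠ σ := by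
  rcases (isOrderedSimplex_stellarSubdivision_iff hσ hc).1 hv with h | ⟨-, τ, -, h⟩
  · exact h
  · have : barycenter σ ∈ Finset.univ.image v := by simp [h]
    obtain ⟨k, -, hk⟩ := Finset.mem_image.1 this
    exact (hb k hk).elim

/-- An `n`-simplex of the subdivision with the vertex `barycenter σ` misses exactly one vertex
of `σ`. -/
theorem IsOrderedSimplex.exists_missing (hcard : σ.card = n + 1)
    (hv : IsOrderedSimplex (stellarSubdivision K σ hσ hc) v) {j : Fin (n + 1)}
    (hj : v j = barycenter σ) :
    ∃ p ∈ σ, p ∉ Set.range v ∧ (∀ q ∈ σ, q ∉ Set.range v → q = p) ∧ ∀ k, k ≠ j → v k ∈ σ := by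
  have hb := K.barycenter_notMem_of_mem_faces hσ.1 hc hσ.1
  rcases (isOrderedSimplex_stellarSubdivision_iff hσ hc).1 hv with ⟨h, -⟩ | ⟨hinj, τ, hτ, h⟩
  · exact (h.ne_barycenter hσ hc j hj).elim
  have hrange : ∀ q, q ∈ Set.range v ↔ q = barycenter σ ∨ q ∈ τ := by
    intro q
    rw [← Finset.mem_insert, ← h]
    simp
  have hcτ : τ.card = n := by
    have h1 := Finset.card_image_of_injective Finset.univ hinj
    rw [h, Finset.card_insert_of_notMem (fun h => hb (hτ.1 h))] at h1
    simpa using h1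
  have hsd : (σ \ τ).card = 1 := by
    rw [Finset.card_sdiff_of_subset hτ.1]
    omega
  obtain ⟨p, hp⟩ := Finset.card_eq_one.1 hsd
  have hp' : ∀ q, q ∈ σ ∧ q ∉ τ ↔ q = p := by
    intro q
    rw [← Finset.mem_sdiff, hp, Finset.mem_singleton]
  have hpσ := (hp' p).2 rfl
  refine ⟨p, hpσ.1, ?_, ?_, ?_⟩
  · rw [hrange]
    rintro (rfl | h)
    exacts [hb hpσ.1, hpσ.2 h]
  · intro q hq hqv
    exact (hp' q).1 ⟨hq, fun h => hqv ((hrange q).2 (Or.inr h))⟩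
  · intro k hk
    rcases (hrange (v k)).1 ⟨k, rfl⟩ with h | h
    · exact (hk (hinj (h.trans hj.symm))).elim
    · exact hτ.1 h

omit [DecidableEq (EuclideanSpace ℝ (Fin m))] in
theorem Function.Injective.update_of_notMem_range {α β : Type*} [DecidableEq α] {f : α → β}
    (hf : Function.Injective f) (a : α) {b : β} (hb : b ∉ Set.range f) :
    Function.Injective (Function.update f a b) := by
  intro x y hxy
  have hb' : ∀ z, f z ≠ b := fun z hz => hb ⟨z, hz⟩
  by_cases hx : x = a <;> by_cases hy : y = a
  · rw [hx, hy]
  · subst hx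
    simp only [Function.update_self, Function.update_of_ne hy] at hxy
    exact (hb' y hxy.symm).elim
  · subst hy
    simp only [Function.update_self, Function.update_of_ne hx] at hxy
    exact (hb' x hxy).elim
  · simp only [Function.update_of_ne hy, Function.update_of_ne hx] at hxy
    exact hf hxy

include hσ in
theorem isOrderedSimplex_of_forall_mem (hcard : σ.card = n + 1) (hv : Function.Injective v)
    (h : ∀ k, v k ∈ σ) : IsOrderedSimplex K v ∧ Finset.univ.image v = σ := by
  have : Finset.univ.image v = σ := by
    refine Finset.eq_of_subset_of_card_le (Finset.image_subset_iff.2 fun k _ => h k) ?_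
    rw [Finset.card_image_of_injective _ hv, hcard]
    simp
  rw [isOrderedSimplex_iff, this]
  exact ⟨⟨hv, hσ.1⟩, rfl⟩

/-- A new simplex inherits the sign of the ordering of σ obtained by putting the missing vertex in
place of the barycenter. Coherence has three cases: across a facet of σ, or between two old
simplices, it reduces to coherence in `K`; between two new simplices, the filled lists are orderings
of σ that differ by a transposition. -/
theorem IsOrientation.subdivide {o : (Fin (n + 1) → EuclideanSpace ℝ (Fin m)) → ℤˣ}
    (ho : IsOrientation K n o) (hcard : σ.card = n + 1) :
    IsOrientation (stellarSubdivision K σ hσ hc) n (fun v => o (fillVertex σ v)) := by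
  have hb := K.barycenter_notMem_of_mem_faces hσ.1 hc hσ.1
  have hfill : ∀ {v : Fin (n + 1) → EuclideanSpace ℝ (Fin m)},
      IsOrderedSimplex (stellarSubdivision K σ hσ hc) v → ∀ j, v j = barycenter σ →
      ∀ p ∈ σ, p ∉ Set.range v → fillVertex σ v = Function.update v j p ∧
        IsOrderedSimplex K (Function.update v j p) ∧
        Finset.univ.image (Function.update v j p) = σ := by
    intro v hv j hj p hp hpv
    obtain ⟨q, hq, hqv, huniq, hmem⟩ := hv.exists_missing hσ hc hcard hj
    obtain rfl := huniq p hp hpv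
    have hinj : Function.Injective v := (isOrderedSimplex_iff.1 hv).1
    refine ⟨fillVertex_eq_update hinj hj hq hqv huniq,
      isOrderedSimplex_of_forall_mem hσ hcard (hinj.update_of_notMem_range j hqv) fun k => ?_⟩
    by_cases hk : k = j
    · subst hk
      simpa using hp
    · simpa [hk] using hmem k hk
  have hcone : ∀ (x y : EuclideanSpace ℝ (Fin m)) (w : Fin n → EuclideanSpace ℝ (Fin m)),
      IsOrderedSimplex (stellarSubdivision K σ hσ hc)
        (Fin.cons x w : Fin (n + 1) → EuclideanSpace ℝ (Fin m)) →
      IsOrderedSimplex (stellarSubdivision K σ hσ hc)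
        (Fin.cons y w : Fin (n + 1) → EuclideanSpace ℝ (Fin m)) →
      x ≠ y → x = barycenter σ →
      o (fillVertex σ (Fin.cons x w : Fin (n + 1) → EuclideanSpace ℝ (Fin m))) =
        -o (fillVertex σ (Fin.cons y w : Fin (n + 1) → EuclideanSpace ℝ (Fin m))) := by
    intro x y w hx hy hxy hxb
    obtain ⟨p, hp, hpv, -⟩ := hx.exists_missing hσ hc hcard (j := 0) hxb
    obtain ⟨h1, h2, h3⟩ := hfill hx 0 hxb p hp hpv
    rw [Fin.update_cons_zero] at h1 h2 h3
    have hxw : ∀ k, (Fin.cons y w : Fin (n + 1) → EuclideanSpace ℝ (Fin m)) k ≠ barycenter σ := by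
      intro k
      refine Fin.cases ?_ (fun k => ?_) k
      · simpa [← hxb] using hxy.symm
      · intro hk
        have := (isOrderedSimplex_iff.1 hx).1 (a₁ := 0) (a₂ := k.succ)
          (by simpa [hxb] using hk.symm)
        exact absurd this.symm (Fin.succ_ne_zero k)
    obtain ⟨h4, h5⟩ := hy.of_stellarSubdivision hσ hc hxw
    rw [h1, fillVertex_of_notMem hxw]
    -- Here `p ≠ y`, since `p` and `w` span σ, which is no longer a face, whereas `y` and `w` span a
    -- face that was kept.
    refine ho.coherent p y w h2 h4 ?_
    rintro rfl
    exact h5 h3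
  refine ⟨fun v π hv => ?_, fun x y w hx hy hxy => ?_⟩
  · simp only [fillVertex_comp_perm]
    by_cases h : ∃ j, v j = barycenter σ
    · obtain ⟨j, hj⟩ := h
      obtain ⟨p, hp, hpv, -⟩ := hv.exists_missing hσ hc hcard hj
      obtain ⟨h1, h2, -⟩ := hfill hv j hj p hp hpv
      rw [h1]
      exact ho.perm _ _ h2
    · push Not at h
      rw [fillVertex_of_notMem h]
      exact ho.perm _ _ (hv.of_stellarSubdivision hσ hc h).1
  · by_cases hxb : x = barycenter σ
    · exact hcone x y w hx hy hxy hxb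
    by_cases hyb : y = barycenter σ
    · exact neg_eq_iff_eq_neg.1 (hcone y x w hy hx hxy.symm hyb).symm
    by_cases hw : ∃ k, w k = barycenter σ
    · obtain ⟨k, hk⟩ := hw
      have key : ∀ x y : EuclideanSpace ℝ (Fin m),
          IsOrderedSimplex (stellarSubdivision K σ hσ hc)
            (Fin.cons x w : Fin (n + 1) → EuclideanSpace ℝ (Fin m)) →
          IsOrderedSimplex (stellarSubdivision K σ hσ hc)
            (Fin.cons y w : Fin (n + 1) → EuclideanSpace ℝ (Fin m)) → x ≠ y →
          y ∈ σ ∧ y ∉ Set.range (Fin.cons x w : Fin (n + 1) → EuclideanSpace ℝ (Fin m)) := by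
        intro x y hx hy hxy
        obtain ⟨-, -, -, -, hmem⟩ := hy.exists_missing hσ hc hcard (j := k.succ) (by simpa)
        refine ⟨hmem 0 (Fin.succ_ne_zero k).symm, ?_⟩
        rintro ⟨l, hl⟩
        refine Fin.cases (fun hl => ?_) (fun l hl => ?_) l hl
        · exact hxy hl
        · have := (isOrderedSimplex_iff.1 hy).1 (a₁ := 0) (a₂ := l.succ) (by simpa using hl.symm)
          exact absurd this.symm (Fin.succ_ne_zero l)
      obtain ⟨hyσ, hyr⟩ := key x y hx hy hxy
      obtain ⟨hxσ, hxr⟩ := key y x hy hx hxy.symm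
      obtain ⟨h1, h2, -⟩ := hfill hx k.succ (by simpa) y hyσ hyr
      obtain ⟨h3, h4, -⟩ := hfill hy k.succ (by simpa) x hxσ hxr
      -- Each of `x`, `y` is the vertex missing from the other simplex, so filling yields the same
      -- list with `x` and `y` exchanged.
      have hswap : Function.update (Fin.cons y w : Fin (n + 1) → EuclideanSpace ℝ (Fin m)) k.succ x =
          Function.update (Fin.cons x w : Fin (n + 1) → EuclideanSpace ℝ (Fin m)) k.succ y ∘
            Equiv.swap 0 k.succ := by
        ext1 l
        refine Fin.cases ?_ (fun l => ?_) l
        · simp [(Fin.succ_ne_zero k).symm]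
        · by_cases hl : l = k
          · subst hl
            simp [(Fin.succ_ne_zero l).symm]
          · have hl' : l.succ ≠ k.succ := fun h => hl (Fin.succ_injective _ h)
            simp [Equiv.swap_apply_of_ne_of_ne (Fin.succ_ne_zero l) hl', hl]
      rw [h1, h3, hswap, ho.perm _ _ h2, Equiv.Perm.sign_swap (Fin.succ_ne_zero k).symm]
      simp
    · push Not at hw
      have aux : ∀ z, z ≠ barycenter σ → ∀ k,
          (Fin.cons z w : Fin (n + 1) → EuclideanSpace ℝ (Fin m)) k ≠ barycenter σ := by
        intro z hz k
        refine Fin.cases ?_ (fun k => ?_) k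
        · exact hz
        · exact hw k
      rw [fillVertex_of_notMem (aux x hxb), fillVertex_of_notMem (aux y hyb)]
      exact ho.coherent x y w (hx.of_stellarSubdivision hσ hc (aux x hxb)).1
        (hy.of_stellarSubdivision hσ hc (aux y hyb)).1 hxy

end Orientation

/-! ### The sign of exchanging two labels -/

section Sign

variable {n : ℕ}

/-- Exchanging the labels `c` and `i` in `i.succAbove` gives a rearrangement of `c.succAbove`. -/
theorem exists_perm_swap_comp_succAbove {c i : Fin (n + 2)} (h : i ≠ c) :
    ∃ π : Equiv.Perm (Fin (n + 1)), Equiv.swap c i ∘ i.succAbove = c.succAbove ∘ π ∧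
      (-1 : ℤ) ^ (i : ℕ) * (Equiv.Perm.sign π : ℤ) = -(-1) ^ (c : ℕ) := by
  -- `i.cycleRange` sends `i` to 0 and `i.succAbove j` to `j.succ`, with sign `(-1)^i`. Thus ρ fixes
  -- 0 and induces π on the successors, so their signs agree.
  let ρ : Equiv.Perm (Fin (n + 2)) := c.cycleRange * Equiv.swap c i * i.cycleRange⁻¹
  obtain ⟨⟨p, π⟩, hπ⟩ := Equiv.Perm.decomposeFin.symm.surjective ρ
  have hp : p = 0 := by
    have h0 : ρ 0 = 0 := by simp [ρ, Equiv.Perm.inv_def]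
    rw [← hπ] at h0
    simpa using h0
  subst hp
  have hsucc : ∀ j, ρ j.succ = (π j).succ := by
    intro j
    rw [← hπ]
    simp
  refine ⟨π, ?_, ?_⟩
  · ext1 j
    have h1 := hsucc j
    simp only [ρ, Equiv.Perm.mul_apply, Equiv.Perm.inv_def, Fin.cycleRange_symm_succ] at h1
    have h2 := congrArg c.cycleRange.symm h1
    simpa using h2
  · have hs : Equiv.Perm.sign ρ = Equiv.Perm.sign π := by
      rw [← hπ, Equiv.Perm.decomposeFin.symm_sign]
      simp
    rw [← hs]
    simp only [ρ, map_mul, map_inv, Fin.sign_cycleRange, Equiv.Perm.sign_swap h.symm]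
    have hi : (-1 : ℤ) ^ (i : ℕ) * (-1) ^ (i : ℕ) = 1 := by
      rw [← mul_pow]; simp
    push_cast
    simp only [Int.units_inv_eq_self]
    push_cast
    linear_combination (-(-1) ^ (c : ℕ) : ℤ) * hi

end Sign

/-! ### Change of the degree under subdivision -/

section Count

variable {m n : ℕ}

/-- The orderings of `n`-simplices that the labelling maps onto the simplex opposite to `i`. -/
def simplicesOver (K : SimplicialComplex ℝ (EuclideanSpace ℝ (Fin m)))
    (L : EuclideanSpace ℝ (Fin m) → Fin (n + 2)) (i : Fin (n + 2)) :
    Set (Fin (n + 1) → EuclideanSpace ℝ (Fin m)) :=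
  {v | IsOrderedSimplex K v ∧ L ∘ v = i.succAbove}

/-- The nondegenerate simplices on which the labelling reverses the orientation. -/
def reversedSimplices (K : SimplicialComplex ℝ (EuclideanSpace ℝ (Fin m)))
    (o : (Fin (n + 1) → EuclideanSpace ℝ (Fin m)) → ℤˣ)
    (L : EuclideanSpace ℝ (Fin m) → Fin (n + 2)) :
    Set (Fin (n + 1) → EuclideanSpace ℝ (Fin m)) :=
  {v | ∃ i, v ∈ simplicesOver K L i ∧ (-1) ^ (i : ℕ) * (o v : ℤ) = -1}

theorem signedCount_eq (K : SimplicialComplex ℝ (EuclideanSpace ℝ (Fin m)))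
    (o : (Fin (n + 1) → EuclideanSpace ℝ (Fin m)) → ℤˣ)
    (L : EuclideanSpace ℝ (Fin m) → Fin (n + 2)) (i : Fin (n + 2)) :
    signedCount K o L i = ∑ᶠ v ∈ simplicesOver K L i, (-1) ^ (i : ℕ) * (o v : ℤ) := rfl

theorem finite_simplicesOver {K : SimplicialComplex ℝ (EuclideanSpace ℝ (Fin m))}
    (hK : K.faces.Finite) (L : EuclideanSpace ℝ (Fin m) → Fin (n + 2)) (i : Fin (n + 2)) :
    (simplicesOver K L i).Finite :=
  (finite_setOf_isOrderedSimplex hK).subset fun _ h => h.1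

theorem finite_reversedSimplices {K : SimplicialComplex ℝ (EuclideanSpace ℝ (Fin m))}
    (hK : K.faces.Finite) (o : (Fin (n + 1) → EuclideanSpace ℝ (Fin m)) → ℤˣ)
    (L : EuclideanSpace ℝ (Fin m) → Fin (n + 2)) : (reversedSimplices K o L).Finite :=
  (finite_setOf_isOrderedSimplex hK).subset fun _ ⟨_, h, _⟩ => h.1

/-- The vertices of `σ` and its barycenter, listed by their labels. -/
noncomputable def coneVertices (σ : Finset (EuclideanSpace ℝ (Fin m)))
    (v₀ : Fin (n + 1) → EuclideanSpace ℝ (Fin m)) (c : Fin (n + 2)) :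
    Fin (n + 2) → EuclideanSpace ℝ (Fin m) :=
  c.insertNth (barycenter σ) v₀

theorem coneVertices_comp_succAbove_self {σ : Finset (EuclideanSpace ℝ (Fin m))} {c : Fin (n + 2)}
    {v₀ : Fin (n + 1) → EuclideanSpace ℝ (Fin m)} : coneVertices σ v₀ c ∘ c.succAbove = v₀ := by
  ext1 j
  simp [coneVertices]

variable [DecidableEq (EuclideanSpace ℝ (Fin m))]
  {K : SimplicialComplex ℝ (EuclideanSpace ℝ (Fin m))}
  {σ : Finset (EuclideanSpace ℝ (Fin m))} (hσ : σ ∈ K.facets) (hc : 2 ≤ σ.card)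
  {L : EuclideanSpace ℝ (Fin m) → Fin (n + 2)} {c : Fin (n + 2)}
  {v₀ : Fin (n + 1) → EuclideanSpace ℝ (Fin m)}

variable (h₀ : v₀ ∈ simplicesOver K L c) (hv₀ : Finset.univ.image v₀ = σ)

include hσ hc h₀ in
theorem update_comp_coneVertices :
    Function.update L (barycenter σ) c ∘ coneVertices σ v₀ c = id := by
  ext1 i
  refine Fin.succAboveCases c ?_ (fun j => ?_) i
  · simp [coneVertices]
  · have hne := h₀.1.ne_barycenter hσ hc j
    simp only [coneVertices, Function.comp_apply, Fin.insertNth_apply_succAbove, id]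
    rw [Function.update_of_ne hne]
    exact congrFun h₀.2 j

include hσ hc h₀ hv₀ in
theorem coneVertices_update {y : EuclideanSpace ℝ (Fin m)} (hy : y ∈ σ ∨ y = barycenter σ) :
    coneVertices σ v₀ c (Function.update L (barycenter σ) c y) = y := by
  have : ∃ i, coneVertices σ v₀ c i = y := by
    rcases hy with hy | rfl
    · rw [← hv₀] at hy
      obtain ⟨j, -, rfl⟩ := Finset.mem_image.1 hy
      exact ⟨c.succAbove j, by simp [coneVertices]⟩
    · exact ⟨c, by simp [coneVertices]⟩
  obtain ⟨i, rfl⟩ := this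
  have := congrFun (update_comp_coneVertices hσ hc h₀) i
  simp only [Function.comp_apply, id] at this
  rw [this]

theorem update_barycenter_comp {v : Fin (n + 1) → EuclideanSpace ℝ (Fin m)}
    (hv : ∀ k, v k ≠ barycenter σ) :
    Function.update L (barycenter σ) c ∘ v = L ∘ v := by
  ext1 k
  simp [hv k]

include hσ h₀ hv₀ in
-- With the barycenter labelled `c`, the labels on σ and its barycenter are all distinct, so a
-- simplex with these vertices is determined, together with its ordering, by its omitted label.
-- Omitting `c` would give σ itself, which has been removed.
theorem mem_simplicesOver_stellarSubdivision {i : Fin (n + 2)}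
    {v : Fin (n + 1) → EuclideanSpace ℝ (Fin m)} :
    v ∈ simplicesOver (stellarSubdivision K σ hσ hc) (Function.update L (barycenter σ) c) i ↔
      (v ∈ simplicesOver K L i ∧ v ≠ v₀) ∨ (i ≠ c ∧ v = coneVertices σ v₀ c ∘ i.succAbove) := by
  have hcard : σ.card = n + 1 := by
    rw [← hv₀, Finset.card_image_of_injective _ (isOrderedSimplex_iff.1 h₀.1).1]
    simp
  have hid := update_comp_coneVertices hσ hc h₀
  have hinj : Function.Injective (coneVertices σ v₀ c) :=
    Function.LeftInverse.injective (g := Function.update L (barycenter σ) c) (congrFun hid)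
  constructor
  · rintro ⟨hv, hL⟩
    by_cases hb : ∃ j, v j = barycenter σ
    · obtain ⟨j, hj⟩ := hb
      obtain ⟨p, hp, hpv, huniq, hmem⟩ := hv.exists_missing hσ hc hcard hj
      refine Or.inr ⟨?_, ?_⟩
      · rintro rfl
        have := congrFun hL j
        simp only [Function.comp_apply, hj, Function.update_self] at this
        exact (Fin.succAbove_ne _ _) this.symm
      · ext1 k
        have hk : v k ∈ σ ∨ v k = barycenter σ := by
          by_cases hkj : k = j
          · exact Or.inr (hkj ▸ hj)
          · exact Or.inl (hmem k hkj)
        rw [← hL]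
        exact (coneVertices_update hσ hc h₀ hv₀ hk).symm
    · push Not at hb
      obtain ⟨h1, h2⟩ := hv.of_stellarSubdivision hσ hc hb
      rw [update_barycenter_comp hb] at hL
      refine Or.inl ⟨⟨h1, hL⟩, ?_⟩
      rintro rfl
      exact h2 hv₀
  · rintro (⟨hv, hne⟩ | ⟨hic, rfl⟩)
    · have hb := hv.1.ne_barycenter hσ hc
      refine ⟨(isOrderedSimplex_stellarSubdivision_iff hσ hc).2 (Or.inl ⟨hv.1, fun himg => hne ?_⟩),
        by rw [update_barycenter_comp hb]; exact hv.2⟩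
      have hmem : ∀ k, v k ∈ σ := fun k => himg ▸ Finset.mem_image_of_mem v (Finset.mem_univ k)
      have hmem₀ : ∀ k, v₀ k ∈ σ := fun k => hv₀ ▸ Finset.mem_image_of_mem v₀ (Finset.mem_univ k)
      have hrange : Set.range v = Set.range v₀ := by
        rw [← Set.image_univ, ← Set.image_univ, ← Finset.coe_univ, ← Finset.coe_image,
          ← Finset.coe_image, himg, hv₀]
      -- The label sets of `v` and `v₀` are the complements of `i` and `c`.
      have hic : i = c := by
        have h1 := congrArg (fun S => L '' S) hrange
        simp only [← Set.range_comp, hv.2, h₀.2, Fin.range_succAbove] at h1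
        simpa using h1
      ext1 k
      rw [← coneVertices_update hσ hc h₀ hv₀ (Or.inl (hmem k)),
        ← coneVertices_update hσ hc h₀ hv₀ (Or.inl (hmem₀ k)),
        Function.update_of_ne (hb k), Function.update_of_ne (h₀.1.ne_barycenter hσ hc k)]
      exact congrArg _ ((congrFun hv.2 k).trans (hic ▸ (congrFun h₀.2 k).symm))
    · refine ⟨(isOrderedSimplex_stellarSubdivision_iff hσ hc).2 (Or.inr
        ⟨hinj.comp Fin.succAbove_right_injective, ?_⟩), by rw [← Function.comp_assoc, hid]; rfl⟩
      obtain ⟨j, rfl⟩ := Fin.exists_succAbove_eq hic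
      refine ⟨σ.erase (v₀ j), Finset.erase_ssubset (hv₀ ▸ Finset.mem_image_of_mem v₀ (by simp)), ?_⟩
      have hbσ := K.barycenter_notMem_of_mem_faces hσ.1 hc hσ.1
      have hbj : v₀ j ≠ barycenter σ := h₀.1.ne_barycenter hσ hc j
      ext y
      simp only [Finset.mem_image, Finset.mem_univ, true_and, Function.comp_apply,
        Finset.mem_insert, Finset.mem_erase]
      have hvj : coneVertices σ v₀ c (c.succAbove j) = v₀ j := by simp [coneVertices]
      constructor
      · rintro ⟨k, rfl⟩
        have hne : coneVertices σ v₀ c ((c.succAbove j).succAbove k) ≠ v₀ j := by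
          rw [← hvj]
          exact fun h => Fin.succAbove_ne _ _ (hinj h)
        generalize (c.succAbove j).succAbove k = l at *
        revert hne
        refine Fin.succAboveCases c ?_ (fun l hne => ?_) l
        · simp [coneVertices]
        · refine Or.inr ⟨hne, ?_⟩
          simp [coneVertices, ← hv₀]
      · intro hy
        have hyσ : y ∈ σ ∨ y = barycenter σ := hy.symm.imp_left And.right
        have hcy := coneVertices_update hσ hc h₀ hv₀ hyσ
        have hne : Function.update L (barycenter σ) c y ≠ c.succAbove j := by
          intro h
          rw [h, hvj] at hcy
          rcases hy with rfl | hy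
          · exact hbj hcy
          · exact hy.1 hcy.symm
        obtain ⟨k, hk⟩ := Fin.exists_succAbove_eq hne
        exact ⟨k, by rw [hk, hcy]⟩

include hσ hc h₀ hv₀ in
theorem sign_fillVertex_coneVertices {o : (Fin (n + 1) → EuclideanSpace ℝ (Fin m)) → ℤˣ}
    (ho : IsOrientation K n o) {i : Fin (n + 2)} (hi : i ≠ c) :
    (-1) ^ (i : ℕ) * (o (fillVertex σ (coneVertices σ v₀ c ∘ i.succAbove)) : ℤ) =
      -((-1) ^ (c : ℕ) * (o v₀ : ℤ)) := by
  have hcard : σ.card = n + 1 := by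
    rw [← hv₀, Finset.card_image_of_injective _ (isOrderedSimplex_iff.1 h₀.1).1]
    simp
  have hid := update_comp_coneVertices hσ hc h₀
  have hinj : Function.Injective (coneVertices σ v₀ c) :=
    Function.LeftInverse.injective (g := Function.update L (barycenter σ) c) (congrFun hid)
  obtain ⟨π, h1, h2⟩ := exists_perm_swap_comp_succAbove hi
  have hmem := (mem_simplicesOver_stellarSubdivision hσ hc h₀ hv₀ (i := i)).2 (Or.inr ⟨hi, rfl⟩)
  obtain ⟨j, hj⟩ := Fin.exists_succAbove_eq hi.symm
  have hjb : (coneVertices σ v₀ c ∘ i.succAbove) j = barycenter σ := by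
    simp [hj, coneVertices]
  obtain ⟨p, hp, hpv, huniq, -⟩ := hmem.1.exists_missing hσ hc hcard hjb
  have hip : coneVertices σ v₀ c i = p := by
    refine huniq _ ?_ ?_
    · obtain ⟨l, rfl⟩ := Fin.exists_succAbove_eq hi
      simp [coneVertices, ← hv₀]
    · rintro ⟨k, hk⟩
      exact Fin.succAbove_ne _ _ (hinj hk)
  -- Filling puts the vertex labelled `i` where the barycenter, labelled `c`, stood; on labels this
  -- is the transposition of `c` and `i`.
  have hfill : fillVertex σ (coneVertices σ v₀ c ∘ i.succAbove) = v₀ ∘ π := by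
    rw [fillVertex_eq_update (hinj.comp Fin.succAbove_right_injective) hjb hp hpv huniq,
      ← coneVertices_comp_succAbove_self (σ := σ) (v₀ := v₀) (c := c), Function.comp_assoc, ← h1,
      coneVertices_comp_succAbove_self]
    ext1 k
    by_cases hk : k = j
    · subst hk
      simp [hj, hip]
    · have h3 : i.succAbove k ≠ c := fun h => hk (Fin.succAbove_right_injective (h.trans hj.symm))
      simp [hk, Equiv.swap_apply_of_ne_of_ne h3 (Fin.succAbove_ne i k)]
  rw [hfill, ho.perm _ _ h₀.1]
  push_cast
  linear_combination (o v₀ : ℤ) * h2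

include h₀ hv₀ in
-- For `i = c` the term of `v₀` disappears; for every other `i` a single term of the opposite sign
-- appears. The change is the same for all `i`, so having a degree is preserved.
theorem signedCount_stellarSubdivision {o : (Fin (n + 1) → EuclideanSpace ℝ (Fin m)) → ℤˣ}
    (ho : IsOrientation K n o) (hK : K.faces.Finite) (i : Fin (n + 2)) :
    signedCount (stellarSubdivision K σ hσ hc) (fun v => o (fillVertex σ v))
        (Function.update L (barycenter σ) c) i =
      signedCount K o L i - (-1) ^ (c : ℕ) * (o v₀ : ℤ) := by
  simp only [signedCount_eq]
  have hcongr : ∀ S : Set (Fin (n + 1) → EuclideanSpace ℝ (Fin m)), S ⊆ simplicesOver K L i →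
      ∑ᶠ v ∈ S, (-1) ^ (i : ℕ) * (o (fillVertex σ v) : ℤ) =
        ∑ᶠ v ∈ S, (-1) ^ (i : ℕ) * (o v : ℤ) := by
    intro S hS
    refine finsum_mem_congr rfl fun v hv => ?_
    rw [fillVertex_of_notMem ((hS hv).1.ne_barycenter hσ hc)]
  have hfin := finite_simplicesOver hK L i
  by_cases hi : i = c
  · subst hi
    have hset : simplicesOver (stellarSubdivision K σ hσ hc) (Function.update L (barycenter σ) i) i =
        simplicesOver K L i \ {v₀} := by
      ext v
      rw [mem_simplicesOver_stellarSubdivision hσ hc h₀ hv₀]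
      simp
    rw [hset, hcongr _ Set.sdiff_subset]
    have := finsum_mem_insert (fun v => (-1) ^ (i : ℕ) * (o v : ℤ)) (s := simplicesOver K L i \ {v₀})
      (a := v₀) (by simp) (hfin.subset Set.sdiff_subset)
    rw [Set.insert_sdiff_singleton, Set.insert_eq_of_mem h₀] at this
    rw [this]
    ring
  · have hset : simplicesOver (stellarSubdivision K σ hσ hc) (Function.update L (barycenter σ) c) i =
        insert (coneVertices σ v₀ c ∘ i.succAbove) (simplicesOver K L i) := by
      ext v
      rw [mem_simplicesOver_stellarSubdivision hσ hc h₀ hv₀, Set.mem_insert_iff]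
      have : v ∈ simplicesOver K L i → v ≠ v₀ := by
        rintro hv rfl
        exact hi (Fin.succAbove_left_injective (hv.2.symm.trans h₀.2))
      tauto
    have hnot : coneVertices σ v₀ c ∘ i.succAbove ∉ simplicesOver K L i := by
      intro h
      obtain ⟨j, hj⟩ := Fin.exists_succAbove_eq (Ne.symm hi)
      exact h.1.ne_barycenter hσ hc j (by simp [hj, coneVertices])
    rw [hset, finsum_mem_insert _ hnot hfin, hcongr _ subset_rfl,
      sign_fillVertex_coneVertices hσ hc h₀ hv₀ ho hi]
    ring

include h₀ hv₀ in
theorem reversedSimplices_diff_subset {o : (Fin (n + 1) → EuclideanSpace ℝ (Fin m)) → ℤˣ} :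
    reversedSimplices K o L \ {v₀} ⊆ reversedSimplices (stellarSubdivision K σ hσ hc)
      (fun v => o (fillVertex σ v)) (Function.update L (barycenter σ) c) := by
  rintro v ⟨⟨i, hv, hs⟩, hne⟩
  refine ⟨i, (mem_simplicesOver_stellarSubdivision hσ hc h₀ hv₀).2 (Or.inl ⟨hv, hne⟩), ?_⟩
  simpa only [fillVertex_of_notMem (hv.1.ne_barycenter hσ hc)] using hs

include h₀ hv₀ in
theorem le_ncard_reversedSimplices {o : (Fin (n + 1) → EuclideanSpace ℝ (Fin m)) → ℤˣ}
    (ho : IsOrientation K n o) (hK : K.faces.Finite) (hs : (-1) ^ (c : ℕ) * (o v₀ : ℤ) = 1) :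
    n + 1 ≤ (reversedSimplices (stellarSubdivision K σ hσ hc)
      (fun v => o (fillVertex σ v)) (Function.update L (barycenter σ) c)).ncard := by
  have hid := update_comp_coneVertices hσ hc h₀
  have hinj : Function.Injective (coneVertices σ v₀ c) :=
    Function.LeftInverse.injective (g := Function.update L (barycenter σ) c) (congrFun hid)
  have hinj' : Function.Injective
      fun j : Fin (n + 1) => coneVertices σ v₀ c ∘ (c.succAbove j).succAbove :=
    fun j k hjk => Fin.succAbove_right_injective
      (Fin.succAbove_left_injective (hinj.comp_left hjk))
  have := Set.ncard_le_ncard (s := Set.range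
      fun j : Fin (n + 1) => coneVertices σ v₀ c ∘ (c.succAbove j).succAbove) ?_
    (finite_reversedSimplices (finite_faces_stellarSubdivision hσ hc hK)
      (fun v => o (fillVertex σ v)) (Function.update L (barycenter σ) c))
  · rwa [← Set.image_univ, Set.ncard_image_of_injective _ hinj', Set.ncard_univ,
      Nat.card_fin] at this
  · rintro _ ⟨j, rfl⟩
    refine ⟨c.succAbove j, (mem_simplicesOver_stellarSubdivision hσ hc h₀ hv₀).2
      (Or.inr ⟨Fin.succAbove_ne _ _, rfl⟩), ?_⟩
    rw [sign_fillVertex_coneVertices hσ hc h₀ hv₀ ho (Fin.succAbove_ne _ _), hs]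

end Count

/-! ### Orientation of the boundary of the simplex by signs of label lists -/

section LabelSign

variable {n : ℕ}

open Classical in
/-- The sign of the permutation of all labels that lists the labels in `f` after the label missing
in `f`. -/
noncomputable def labelSign (f : Fin (n + 1) → Fin (n + 2)) : ℤˣ :=
  if h : ∃ π : Equiv.Perm (Fin (n + 2)), ∀ j, π j.succ = f j then Equiv.Perm.sign h.choose else 1

theorem Equiv.Perm.eq_of_forall_succ {π ρ : Equiv.Perm (Fin (n + 1))}
    (h : ∀ j : Fin n, π j.succ = ρ j.succ) : π = ρ := by
  have h0 : π 0 = ρ 0 := by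
    obtain ⟨k, hk⟩ := π.surjective (ρ 0)
    revert hk
    refine Fin.cases id (fun k hk => ?_) k
    rw [h] at hk
    exact absurd (ρ.injective hk) (Fin.succ_ne_zero k)
  ext1 j
  exact Fin.cases h0 h j

theorem labelSign_eq {f : Fin (n + 1) → Fin (n + 2)} (π : Equiv.Perm (Fin (n + 2)))
    (h : ∀ j, π j.succ = f j) : labelSign f = Equiv.Perm.sign π := by
  have hex : ∃ π : Equiv.Perm (Fin (n + 2)), ∀ j, π j.succ = f j := ⟨π, h⟩
  rw [labelSign, dif_pos hex]
  congr 1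
  exact Equiv.Perm.eq_of_forall_succ fun j => (hex.choose_spec j).trans (h j).symm

theorem exists_perm_extending {f : Fin (n + 1) → Fin (n + 2)} (hf : Function.Injective f) :
    ∃ π : Equiv.Perm (Fin (n + 2)), ∀ j, π j.succ = f j := by
  have : ∃ i, i ∉ Set.range f := by
    by_contra! h
    have := Fintype.card_le_of_surjective f h
    simp at this
  obtain ⟨i, hi⟩ := this
  have hinj : Function.Injective (Fin.cons i f : Fin (n + 2) → Fin (n + 2)) :=
    Fin.cons_injective_iff.2 ⟨hi, hf⟩
  exact ⟨Equiv.ofBijective _ (Finite.injective_iff_bijective.1 hinj), fun j => by simp⟩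

theorem labelSign_comp_perm {f : Fin (n + 1) → Fin (n + 2)} (hf : Function.Injective f)
    (σ : Equiv.Perm (Fin (n + 1))) : labelSign (f ∘ σ) = Equiv.Perm.sign σ * labelSign f := by
  obtain ⟨π, hπ⟩ := exists_perm_extending hf
  rw [labelSign_eq π hπ, labelSign_eq (π * Equiv.Perm.decomposeFin.symm (0, σ)) (by simp [hπ]),
    map_mul, Equiv.Perm.decomposeFin.symm_sign]
  simp [mul_comm]

/-- The label missing from the first list is `y`, so precomposing with the transposition of 0 and 1
turns the extending permutation of one list into that of the other. -/
theorem labelSign_cons {x y : Fin (n + 2)} {f : Fin n → Fin (n + 2)}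
    (hx : Function.Injective (Fin.cons x f : Fin (n + 1) → Fin (n + 2)))
    (hy : Function.Injective (Fin.cons y f : Fin (n + 1) → Fin (n + 2))) (hxy : x ≠ y) :
    labelSign (Fin.cons x f : Fin (n + 1) → Fin (n + 2)) =
      -labelSign (Fin.cons y f : Fin (n + 1) → Fin (n + 2)) := by
  obtain ⟨π, hπ⟩ := exists_perm_extending hx
  have h0 : π 0 = y := by
    obtain ⟨k, hk⟩ := π.surjective y
    revert hk
    refine Fin.cases id (fun k => Fin.cases (fun hk => ?_) (fun k hk => ?_) k) k
    · rw [hπ] at hk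
      exact absurd hk hxy
    · rw [hπ] at hk
      have := hy (a₁ := k.succ) (a₂ := 0) (by simpa using hk)
      exact absurd this (Fin.succ_ne_zero k)
  rw [labelSign_eq π hπ, labelSign_eq (π * Equiv.swap 0 1) (f := Fin.cons y f), map_mul,
    Equiv.Perm.sign_swap (by simp)]
  · simp
  · intro j
    refine Fin.cases ?_ (fun j => ?_) j
    · simpa using h0
    · have h1 : j.succ.succ ≠ 1 := by
        rw [← Fin.succ_zero_eq_one]
        exact fun h => Fin.succ_ne_zero j (Fin.succ_injective _ h)
      rw [Equiv.Perm.mul_apply, Equiv.swap_apply_of_ne_of_ne (Fin.succ_ne_zero _) h1, hπ]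
      simp

theorem labelSign_succAbove (i : Fin (n + 2)) : (labelSign i.succAbove : ℤ) = (-1) ^ (i : ℕ) := by
  rw [labelSign_eq i.cycleRange.symm (by simp)]
  simp

end LabelSign

/-! ### The boundary of the simplex as the starting triangulation of degree 1 -/

section SimplexBoundary

variable {n m : ℕ} [DecidableEq (EuclideanSpace ℝ (Fin m))]

theorem affineIndependent_image_affineBasis
    (β : AffineBasis (Fin (n + 2)) ℝ (EuclideanSpace ℝ (Fin m))) :
    AffineIndependent ℝ ((↑) : (Finset.image β Finset.univ) → EuclideanSpace ℝ (Fin m)) :=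
  β.ind.range.mono fun x hx => by simpa using hx

/-- The boundary complex of the simplex spanned by an affine basis. -/
noncomputable def simplexBoundary (β : AffineBasis (Fin (n + 2)) ℝ (EuclideanSpace ℝ (Fin m))) :
    SimplicialComplex ℝ (EuclideanSpace ℝ (Fin m)) where
  faces := {s | s.Nonempty ∧ s ⊂ Finset.univ.image β}
  isRelLowerSet_faces := fun _ hs => ⟨hs.1, fun _ hts ht => ⟨ht, hts.trans_ssubset hs.2⟩⟩
  indep := fun {s} hs => β.ind.range.mono fun x hx => by
    obtain ⟨i, -, hi⟩ := Finset.mem_image.1 (hs.2.1 hx)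
    exact ⟨i, hi⟩
  inter_subset_convexHull := fun hs ht =>
    ((affineIndependent_image_affineBasis β).convexHull_inter hs.2.1 ht.2.1).ge

variable (β : AffineBasis (Fin (n + 2)) ℝ (EuclideanSpace ℝ (Fin m)))

theorem mem_faces_simplexBoundary {s : Finset (EuclideanSpace ℝ (Fin m))} :
    s ∈ (simplexBoundary β).faces ↔ s.Nonempty ∧ s ⊂ Finset.univ.image β := Iff.rfl

theorem finite_faces_simplexBoundary : (simplexBoundary β).faces.Finite :=
  (Finset.finite_toSet (Finset.univ.image β).powerset).subset fun _ hs =>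
    Finset.mem_coe.2 (Finset.mem_powerset.2 hs.2.1)

theorem card_image_affineBasis : (Finset.univ.image β).card = n + 2 := by
  rw [Finset.card_image_of_injective _ β.ind.injective]
  simp

theorem card_le_of_mem_faces_simplexBoundary :
    ∀ s ∈ (simplexBoundary β).faces, s.card ≤ n + 1 := by
  intro s hs
  have := Finset.card_lt_card hs.2
  rw [card_image_affineBasis] at this
  omega

theorem vertices_simplexBoundary : (simplexBoundary β).vertices = Set.range β := by
  ext x
  rw [SimplicialComplex.mem_vertices, mem_faces_simplexBoundary]
  constructor
  · rintro ⟨-, h⟩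
    simpa using h.1
  · rintro ⟨i, rfl⟩
    refine ⟨Finset.singleton_nonempty _, (Finset.singleton_subset_iff.2 (by simp)).ssubset_of_ne fun h => ?_⟩
    have := card_image_affineBasis β
    rw [← h] at this
    simp at this

/-- Interior points of the simplex are those with all barycentric coordinates positive, so on the
frontier some coordinate vanishes and the point lies in the opposite face. -/
theorem space_simplexBoundary :
    (simplexBoundary β).space = frontier (convexHull ℝ (Set.range β)) := by
  have hcl : IsClosed (convexHull ℝ (Set.range β)) :=
    ((Set.finite_range β).isCompact_convexHull ℝ).isClosed
  have hinj := β.ind.injective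
  rw [hcl.frontier_eq, β.interior_convexHull]
  ext x
  simp only [SimplicialComplex.mem_space_iff, mem_faces_simplexBoundary, Set.mem_sdiff,
    Set.mem_ofPred_eq]
  constructor
  · rintro ⟨s, ⟨-, hs⟩, hx⟩
    obtain ⟨y, hy, hys⟩ := Finset.exists_of_ssubset hs
    obtain ⟨i, -, rfl⟩ := Finset.mem_image.1 hy
    refine ⟨convexHull_mono (fun z hz => by simpa using hs.1 hz) hx, fun hpos => ?_⟩
    have hconv : Convex ℝ (β.coord i ⁻¹' {0}) := (convex_singleton 0).affine_preimage _
    have hsub : (s : Set (EuclideanSpace ℝ (Fin m))) ⊆ β.coord i ⁻¹' {0} := by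
      intro z hz
      obtain ⟨j, -, rfl⟩ := Finset.mem_image.1 (hs.1 hz)
      have hji : i ≠ j := by
        rintro rfl
        exact hys hz
      simp [β.coord_apply_ne hji]
    have := convexHull_min hsub hconv hx
    exact (hpos i).ne' this
  · rintro ⟨hx, hpos⟩
    rw [β.convexHull_eq_nonneg_coord] at hx
    push Not at hpos
    obtain ⟨i, hi⟩ := hpos
    have hi0 : β.coord i x = 0 := le_antisymm hi (hx i)
    refine ⟨(Finset.univ.erase i).image β, ⟨?_, ?_⟩, ?_⟩
    · obtain ⟨j, hj⟩ := exists_ne i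
      exact ⟨β j, Finset.mem_image_of_mem _ (by simp [hj])⟩
    · exact (Finset.image_ssubset_image hinj).2 (Finset.erase_ssubset (Finset.mem_univ i))
    · have h1 := β.sum_coord_apply_eq_one x
      have h2 := β.linear_combination_coord_eq_self x
      rw [← Finset.add_sum_erase _ _ (Finset.mem_univ i), hi0, zero_add] at h1
      rw [← Finset.add_sum_erase _ _ (Finset.mem_univ i), hi0, zero_smul, zero_add] at h2
      rw [← h2]
      refine (convex_convexHull ℝ _).sum_mem (fun j _ => hx j) h1 fun j hj => ?_
      exact subset_convexHull ℝ _ (Finset.mem_coe.2 (Finset.mem_image_of_mem _ hj))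

theorem IsOrderedSimplex.exists_eq_comp {v : Fin (n + 1) → EuclideanSpace ℝ (Fin m)}
    (hv : IsOrderedSimplex (simplexBoundary β) v) :
    Function.Injective (Function.invFun β ∘ v) ∧ β ∘ Function.invFun β ∘ v = v := by
  rw [isOrderedSimplex_iff] at hv
  have heq : β ∘ Function.invFun β ∘ v = v := by
    ext1 k
    have : v k ∈ Finset.univ.image β := hv.2.2.1 (Finset.mem_image_of_mem v (by simp))
    obtain ⟨i, -, hi⟩ := Finset.mem_image.1 this
    exact Function.invFun_eq ⟨i, hi⟩
  refine ⟨?_, heq⟩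
  have := hv.1
  rw [← heq] at this
  exact this.of_comp

theorem isOrientation_simplexBoundary :
    IsOrientation (simplexBoundary β) n (fun v => labelSign (Function.invFun β ∘ v)) := by
  refine ⟨fun v σ hv => ?_, fun x y w hx hy hxy => ?_⟩
  · exact labelSign_comp_perm (hv.exists_eq_comp β).1 σ
  · have hx' := hx.exists_eq_comp β
    have hy' := hy.exists_eq_comp β
    simp only [← Function.comp_def, Fin.comp_cons] at hx' hy' ⊢
    refine labelSign_cons hx'.1 hy'.1 fun h => hxy ?_
    have h1 := congrFun hx'.2 0
    have h2 := congrFun hy'.2 0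
    simp only [Fin.cons_zero] at h1 h2
    rw [← h1, ← h2, h]

theorem simplicesOver_simplexBoundary (i : Fin (n + 2)) :
    simplicesOver (simplexBoundary β) (Function.invFun β) i = {β ∘ i.succAbove} := by
  have hinj := β.ind.injective
  ext v
  rw [Set.mem_singleton_iff]
  constructor
  · rintro ⟨hv, hL⟩
    rw [← (hv.exists_eq_comp β).2, hL]
  · rintro rfl
    refine ⟨isOrderedSimplex_iff.2 ⟨hinj.comp Fin.succAbove_right_injective, ?_⟩, ?_⟩
    · rw [mem_faces_simplexBoundary]
      refine ⟨by simp, ?_⟩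
      rw [← Finset.image_image]
      refine (Finset.image_ssubset_image hinj).2 (Finset.ssubset_univ_iff.2 fun h => ?_)
      have : i ∈ Finset.univ.image i.succAbove := by rw [h]; simp
      simp at this
    · rw [← Function.comp_assoc, Function.invFun_comp hinj]
      rfl

theorem hasDegree_simplexBoundary :
    HasDegree (simplexBoundary β) (fun v : Fin (n + 1) → _ => labelSign (Function.invFun β ∘ v))
      (Function.invFun β) 1 := by
  intro i
  have hL : Function.invFun β ∘ β ∘ i.succAbove = i.succAbove := by
    rw [← Function.comp_assoc, Function.invFun_comp β.ind.injective]
    rfl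
  rw [signedCount_eq, simplicesOver_simplexBoundary, finsum_mem_singleton, hL, labelSign_succAbove,
    ← mul_pow]
  simp

end SimplexBoundary

/-! ### Raising and lowering the degree, and the count of vertices -/

section Construction

/-- There is a triangulation of the `n`-sphere with `N` vertices and a labelling of degree `d`
that reverses the orientation of at least `k` nondegenerate simplices. -/
def AdmitsReversed (n : ℕ) (d : ℤ) (N k : ℕ) : Prop :=
  ∃ (K : SimplicialComplex ℝ (EuclideanSpace ℝ (Fin (n + 1))))
    (o : (Fin (n + 1) → EuclideanSpace ℝ (Fin (n + 1))) → ℤˣ)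
    (L : EuclideanSpace ℝ (Fin (n + 1)) → Fin (n + 2)),
    IsSphereTriangulation n K ∧ IsOrientation K n o ∧ HasDegree K o L d ∧
      K.vertices.ncard = N ∧ (∀ s ∈ K.faces, s.card ≤ n + 1) ∧ k ≤ (reversedSimplices K o L).ncard

variable {n : ℕ}

theorem AdmitsReversed.admitsDegree {d : ℤ} {N k : ℕ} (h : AdmitsReversed n d N k) :
    AdmitsDegree n d N := by
  obtain ⟨K, o, L, h1, h2, h3, h4, -⟩ := h
  exact ⟨n + 1, K, o, L, h1, h2, h3, h4⟩

theorem admitsReversed_one (n : ℕ) : AdmitsReversed n 1 (n + 2) 0 := by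
  classical
  obtain ⟨β⟩ := AffineBasis.exists_affineBasis_of_finiteDimensional
    (ι := Fin (n + 2)) (k := ℝ) (P := EuclideanSpace ℝ (Fin (n + 1))) (by simp)
  refine ⟨simplexBoundary β, _, _, ⟨finite_faces_simplexBoundary β, ?_⟩,
    isOrientation_simplexBoundary β, hasDegree_simplexBoundary β, ?_,
    card_le_of_mem_faces_simplexBoundary β, Nat.zero_le _⟩
  -- A homeomorphism of the ambient space carries the frontier of a bounded convex set with nonempty
  -- interior onto the unit sphere.
  · obtain ⟨h, -, -, hh⟩ := exists_homeomorph_image_interior_closure_frontier_eq_unitBall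
      (convex_convexHull ℝ (Set.range β)) ⟨_, β.centroid_mem_interior_convexHull⟩
      ((Set.finite_range β).isCompact_convexHull ℝ).isBounded
    rw [space_simplexBoundary, ← hh]
    exact ⟨h.image _⟩
  · rw [vertices_simplexBoundary, ← Set.image_univ,
      Set.ncard_image_of_injective _ β.ind.injective, Set.ncard_univ, Nat.card_fin]

/-- The bound on cardinalities makes every n-simplex maximal, as the subdivision requires. -/
theorem mem_facets_of_isOrderedSimplex {m : ℕ} [DecidableEq (EuclideanSpace ℝ (Fin m))]
    {K : SimplicialComplex ℝ (EuclideanSpace ℝ (Fin m))} (hK : ∀ s ∈ K.faces, s.card ≤ n + 1)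
    {v : Fin (n + 1) → EuclideanSpace ℝ (Fin m)} (hv : IsOrderedSimplex K v) :
    Finset.univ.image v ∈ K.facets ∧ (Finset.univ.image v).card = n + 1 := by
  rw [isOrderedSimplex_iff] at hv
  have hcard : (Finset.univ.image v).card = n + 1 := by
    rw [Finset.card_image_of_injective _ hv.1]
    simp
  exact ⟨⟨hv.2, fun t ht h => Finset.eq_of_subset_of_card_le h (by rw [hcard]; exact hK t ht)⟩, hcard⟩

theorem IsSphereTriangulation.subdivide {m : ℕ} [DecidableEq (EuclideanSpace ℝ (Fin m))]
    {K : SimplicialComplex ℝ (EuclideanSpace ℝ (Fin m))} (hK : IsSphereTriangulation n K)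
    {σ : Finset (EuclideanSpace ℝ (Fin m))} (hσ : σ ∈ K.facets) (hc : 2 ≤ σ.card) :
    IsSphereTriangulation n (stellarSubdivision K σ hσ hc) := by
  refine ⟨finite_faces_stellarSubdivision hσ hc hK.1, ?_⟩
  rw [space_stellarSubdivision]
  exact hK.2

theorem AdmitsReversed.succ (hn : 1 ≤ n) {d : ℤ} {N k : ℕ} (h : AdmitsReversed n d N (k + 1)) :
    AdmitsReversed n (d + 1) (N + 1) k := by
  classical
  obtain ⟨K, o, L, hK, ho, hd, hN, hcard, hk⟩ := h
  have hne : (reversedSimplices K o L).Nonempty :=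
    Set.nonempty_of_ncard_ne_zero (by omega)
  obtain ⟨v₀, c, h₀, hs⟩ := hne
  obtain ⟨hσ, hσcard⟩ := mem_facets_of_isOrderedSimplex hcard h₀.1
  -- This needs `n ≥ 1`: the barycenter of a single point would not be a new vertex.
  have hc : 2 ≤ (Finset.univ.image v₀).card := by omega
  refine ⟨_, _, Function.update L (barycenter (Finset.univ.image v₀)) c, hK.subdivide hσ hc, ho.subdivide hσ hc hσcard, fun i => ?_, ?_,
    card_le_of_mem_faces_stellarSubdivision hσ hc hcard, ?_⟩
  · rw [signedCount_stellarSubdivision hσ hc h₀ rfl ho hK.1, hs, hd i]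
    ring
  · rw [ncard_vertices_stellarSubdivision hσ hc hK.1, hN]
  · refine le_trans ?_ (Set.ncard_le_ncard (reversedSimplices_diff_subset hσ hc h₀ rfl)
      (finite_reversedSimplices (finite_faces_stellarSubdivision hσ hc hK.1) _ _))
    rw [Set.ncard_sdiff_singleton_of_mem (show v₀ ∈ reversedSimplices K o L from ⟨c, h₀, hs⟩)]
    omega

theorem AdmitsReversed.pred (hn : 1 ≤ n) {d : ℤ} (hd0 : 0 < d) {N k : ℕ}
    (h : AdmitsReversed n d N k) : AdmitsReversed n (d - 1) (N + 1) (n + 1) := by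
  classical
  obtain ⟨K, o, L, hK, ho, hd, hN, hcard, -⟩ := h
  -- A positive degree forces a simplex of sign +1 over every label; the label 0 is an arbitrary
  -- choice.
  have hex : ∃ v₀ ∈ simplicesOver K L 0, (-1) ^ ((0 : Fin (n + 2)) : ℕ) * (o v₀ : ℤ) = 1 := by
    by_contra! hcon
    have hle : signedCount K o L 0 ≤ 0 := by
      rw [signedCount_eq]
      refine finsum_mem_induction (· ≤ 0) le_rfl (fun _ _ => add_nonpos) fun v hv => ?_
      rcases Int.units_eq_one_or (o v) with h | h
      · exact absurd (by simp [h]) (hcon v hv)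
      · simp [h]
    rw [hd 0] at hle
    omega
  obtain ⟨v₀, h₀, hs⟩ := hex
  obtain ⟨hσ, hσcard⟩ := mem_facets_of_isOrderedSimplex hcard h₀.1
  have hc : 2 ≤ (Finset.univ.image v₀).card := by omega
  refine ⟨_, _, Function.update L (barycenter (Finset.univ.image v₀)) 0, hK.subdivide hσ hc, ho.subdivide hσ hc hσcard, fun i => ?_, ?_,
    card_le_of_mem_faces_stellarSubdivision hσ hc hcard,
    le_ncard_reversedSimplices hσ hc h₀ rfl ho hK.1 hs⟩
  · rw [signedCount_stellarSubdivision hσ hc h₀ rfl ho hK.1, hs, hd i]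
  · rw [ncard_vertices_stellarSubdivision hσ hc hK.1, hN]

/-- Here `k` is the supply of reversed simplices. A raising adds `n` to both sides of the equation,
since it uses up one of them. When the supply is empty, one lowering and two raisings increase the
degree by one, leave `(n + 1) - 2 = n - 1` reversed simplices and add `3 * n` to both sides. -/
theorem exists_admitsReversed (hn : 1 ≤ n) (d : ℕ) :
    ∃ N k : ℕ, AdmitsReversed n ((d + 1 : ℕ) : ℤ) N k ∧ k < n ∧
      n * N + (n + 2) = (n + 2) * (d + 1 + n) + 2 * k := by
  induction d with
  | zero => exact ⟨n + 2, 0, by simpa using admitsReversed_one n, hn, by ring⟩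
  | succ d ih =>
    obtain ⟨N, k, h, hk, hN⟩ := ih
    cases k with
    | succ k =>
      refine ⟨N + 1, k, ?_, by omega, by linarith⟩
      have := h.succ hn
      push_cast at this ⊢
      exact this
    | zero =>
      obtain ⟨l, rfl⟩ : ∃ l, n = l + 1 := ⟨n - 1, by omega⟩
      refine ⟨N + 3, l, ?_, by omega, by linarith⟩
      have := ((h.pred hn (by positivity)).succ hn).succ hn
      push_cast at this ⊢
      convert this using 1
      ring

theorem exists_admitsDegree_le (hn : 1 ≤ n) (d : ℕ) :
    ∃ N : ℕ, AdmitsDegree n (d : ℤ) N ∧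
      (N : ℝ) ≤ ((n : ℝ) + 2) / (n : ℝ) * (d : ℝ) + (2 * (n : ℝ) + 2) := by
  have hn' : (1 : ℝ) ≤ n := by exact_mod_cast hn
  cases d with
  | zero =>
    have h := (admitsReversed_one n).pred hn one_pos
    refine ⟨n + 2 + 1, by simpa using h.admitsDegree, ?_⟩
    push_cast
    linarith
  | succ d =>
    obtain ⟨N, k, h, hk, hN⟩ := exists_admitsReversed hn d
    refine ⟨N, h.admitsDegree, ?_⟩
    have hk' : (k : ℝ) + 1 ≤ n := by exact_mod_cast hk
    have hN' : (n : ℝ) * N + (n + 2) = (n + 2) * (d + 1 + n) + 2 * k := by exact_mod_cast hN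
    have hnpos : (0 : ℝ) < n := by linarith
    rw [← mul_le_mul_iff_right₀ hnpos]
    have : (n : ℝ) * (((n : ℝ) + 2) / n * ((d + 1 : ℕ) : ℝ) + (2 * n + 2)) =
        (n + 2) * (d + 1) + n * (2 * n + 2) := by
      field_simp
      push_cast
      ring
    rw [this]
    -- By `k ≤ n - 1` the constant term is at most `(n + 2) * (n - 1) + 2 * (n - 1) = n^2 + 3 * n -
    -- 4`, which is below `n * (2 * n + 2)`.
    nlinarith

theorem lam_le (hn : 1 ≤ n) (d : ℕ) :
    (lam n (d : ℤ) : ℝ) ≤ ((n : ℝ) + 2) / (n : ℝ) * (d : ℝ) + (2 * (n : ℝ) + 2) := by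
  obtain ⟨N, hN, hle⟩ := exists_admitsDegree_le hn d
  have : lam n (d : ℤ) ≤ N := Nat.sInf_le hN
  exact le_trans (by exact_mod_cast this) hle

theorem alpha_le (hn : 1 ≤ n) : alpha n ≤ ((((n : ℝ) + 2) / (n : ℝ) : ℝ) : EReal) := by
  have hlim : Filter.Tendsto
      (fun d : ℕ => ((((n : ℝ) + 2) / n + (2 * n + 2) / (d : ℝ) : ℝ) : EReal)) Filter.atTop
      (nhds ((((n : ℝ) + 2) / (n : ℝ) : ℝ) : EReal)) := by
    rw [EReal.tendsto_coe]
    simpa using (tendsto_const_div_atTop_nhds_zero_nat (2 * (n : ℝ) + 2)).const_add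
      (((n : ℝ) + 2) / n)
  rw [← hlim.limsup_eq]
  refine Filter.limsup_le_limsup ?_
  filter_upwards [Filter.eventually_gt_atTop 0] with d hd
  rw [EReal.coe_le_coe_iff]
  have hd' : (0 : ℝ) < d := by exact_mod_cast hd
  rw [div_le_iff₀ hd', add_mul, div_mul_cancel₀ _ hd'.ne']
  exact lam_le hn d

end Construction

theorem theorem1 (n : ℕ) (hn : 1 ≤ n) :
    (∀ d : ℕ, (∃ N : ℕ, AdmitsDegree n (d : ℤ) N) ∧
      (lam n (d : ℤ) : ℝ) ≤ ((n : ℝ) + 2) / (n : ℝ) * (d : ℝ) + (2 * (n : ℝ) + 2)) ∧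
    alpha n ≤ ((((n : ℝ) + 2) / (n : ℝ) : ℝ) : EReal) := by
  refine ⟨fun d => ⟨?_, lam_le hn d⟩, alpha_le hn⟩
  obtain ⟨N, hN, -⟩ := exists_admitsDegree_le hn d
  exact ⟨N, hN⟩
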